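/- Let $\widehat{T}^2$ be the Cayley tree (Bethe lattice) with $b=2$, i.e. the infinite $3$-regular tree, with vertex set $V$. A $4$-coloring is a map $\sigma: V\to\{1,2,3,4\}$ with $\sigma(u)\ne\sigma(w)$ for adjacent $u,w$, and $\sigma_U$ denotes its restriction to $U\subseteq V$. An infinite-volume Gibbs measure is a probability measure $p$ on the set of $4$-colorings such that, for every finite $R\subseteq V$ and every $4$-coloring $\sigma$, the conditional distribution under $p$ of the colors in $R$ given that the colors outside of $R$ are $\sigma_{V\setminus R}$ is uniform on the colorings of $R$ that together with $\sigma_{V\setminus R}$ form a $4$-coloring (as an equality of regular conditional distributions). Theorem. There are constants $C>0$ and $a>0$ such that every infinite-volume Gibbs measure $p$ on the $4$-colorings of $\widehat{T}^2$ has strong spatial mixing with rate $\delta(d)=C\exp(-a d)$: for every vertex $v$ and every set $U\subseteq V$, finite or infinite, with $v\notin U$, the conditional distribution $p_v^{\sigma_U}$ of the color of $v$ given $\sigma_U$ has a version such that for every pair of $4$-colorings $\sigma,\phi$, $$\left\| p_v^{\sigma_U}-p_v^{\phi_U}\right\|_{\mathrm{TV}}\le C\exp\bigl(-a\,\mathrm{dist}(v,\Delta)\bigr),$$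 where $\Delta=\{u\in U:\sigma(u)\ne\phi(u)\}$, $\mathrm{dist}(v,\Delta)=\min_{u\in\Delta}\mathrm{dist}(v,u)$ and $\|\cdot\|_{\mathrm{TV}}$ is the total variation distance (if $\Delta=\emptyset$, the left-hand side is $0$). -/

import Mathlib

open MeasureTheory ProbabilityTheory

/-- The proper `q`-colorings of the graph `G`, as maps from the vertices to `Fin q`.
They carry the σ-algebra generated by the colors of single vertices. -/
abbrev QColoring {V : Type*} (G : SimpleGraph V) (q : ℕ) : Type _ :=
  {σ : V → Fin q // ∀ u w : V, G.Adj u w → σ u ≠ σ w}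

/-- The restriction `σ_U` of a `q`-coloring to a set `U` of vertices. -/
def QColoring.restr {V : Type*} {G : SimpleGraph V} {q : ℕ} (U : Set V) (σ : QColoring G q) :
    U → Fin q :=
  fun u => σ.1 u

/-- The Markov kernel `κ` is a (regular) conditional distribution of `Y` given `X` under `p`. -/
def IsCondDistribution {Ω A B : Type*} [MeasurableSpace Ω] [MeasurableSpace A]
    [MeasurableSpace B] (p : Measure Ω) (Y : Ω → B) (X : Ω → A) (κ : Kernel A B) : Prop :=
  IsMarkovKernel κ ∧ p.map (fun ω => (X ω, Y ω)) = (p.map X).compProd κ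

/-- The colorings of the region `R` that, together with the colors of `σ` outside of `R`,
form a `q`-coloring of `G`. -/
def regionColorings {V : Type*} {G : SimpleGraph V} {q : ℕ} (R : Set V) (σ : QColoring G q) :
    Set (R → Fin q) :=
  {ξ | ∃ τ : QColoring G q, (∀ x, x ∉ R → τ.1 x = σ.1 x) ∧ τ.restr R = ξ}

/-- `p` is an infinite-volume Gibbs measure on the `q`-colorings of `G`: it is a probability
measure, and for every finite region `R` the conditional distribution of the colors in `R` given
the colors outside of `R` is, for every `q`-coloring `σ` prescribing the outside colors, the
uniform distribution on the compatible colorings of `R`. -/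
def IsGibbsMeasure {V : Type*} (G : SimpleGraph V) (q : ℕ) (p : Measure (QColoring G q)) : Prop :=
  IsProbabilityMeasure p ∧
    ∀ R : Set V, R.Finite →
      ∃ κ : Kernel ((Rᶜ : Set V) → Fin q) (R → Fin q),
        IsCondDistribution p (QColoring.restr R) (QColoring.restr Rᶜ) κ ∧
          ∀ σ : QColoring G q, κ (σ.restr Rᶜ) = uniformOn (regionColorings R σ)

/-- The vertices of `U` on which `σ` and `φ` differ. -/
def disagreement {V : Type*} {G : SimpleGraph V} {q : ℕ} (U : Set V) (σ φ : QColoring G q) :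
    Set V :=
  {u | u ∈ U ∧ σ.1 u ≠ φ.1 u}

/-- `dist(v, D) = min_{u ∈ D} dist(v, u)`, used for nonempty `D` in a connected graph. -/
noncomputable def distToSet {V : Type*} (G : SimpleGraph V) (v : V) (D : Set V) : ℕ :=
  sInf ((fun u => G.dist v u) '' D)

/-- The total variation distance of two probability distributions on `q` colors. -/
noncomputable def tvDist {q : ℕ} (μ ν : Measure (Fin q)) : ℝ :=
  (1 / 2) * ∑ c : Fin q, |μ.real {c} - ν.real {c}|

/-- Strong spatial mixing of `p` with rate `δ`: for every vertex `v` and every set `U` of vertices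
not containing `v`, finite or infinite, the conditional marginal `p_v^{σ_U}` of the color of `v`
given the colors on `U` has a version `κ` such that, for all `q`-colorings `σ` and `φ`,
the total variation distance of `p_v^{σ_U}` and `p_v^{φ_U}` is at most `δ (dist(v, Δ))`, where `Δ`
is the set of vertices of `U` on which `σ` and `φ` differ. (If `Δ` is empty, the two marginals are
the same measure.) -/
def HasStrongSpatialMixing {V : Type*} (G : SimpleGraph V) (q : ℕ) (p : Measure (QColoring G q))
    (δ : ℕ → ℝ) : Prop :=
  ∀ (v : V) (U : Set V), v ∉ U →
    ∃ κ : Kernel (U → Fin q) (Fin q),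
      IsCondDistribution p (fun σ : QColoring G q => σ.1 v) (QColoring.restr U) κ ∧
        ∀ σ φ : QColoring G q, (disagreement U σ φ).Nonempty →
          tvDist (κ (σ.restr U)) (κ (φ.restr U)) ≤ δ (distToSet G v (disagreement U σ φ))

/-- `G` is a Cayley tree (Bethe lattice) with parameter `b`: an infinite `(b + 1)`-regular tree. -/
structure IsCayleyTree {V : Type*} (b : ℕ) (G : SimpleGraph V) : Prop where
  infinite : Infinite V
  isTree : G.IsTree
  regular : ∀ v : V, (G.neighborSet v).encard = b + 1

/-! Root the tree at `v`. With the colors on `U` and on a far level prescribed, the marginal at the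
root of a uniform coloring is computed by the sum-product recursion: the message of a free vertex is
the normalized product of `1 - x` over the messages `x` of its children. Mixing is therefore a
contraction property of this recursion.

For two children with messages `x` and `y` the normalizing constant is `2 + ∑ c, x c * y c`, and
replacing one child's message by another multiplies the `ℓ¹` error by at most the inverse of such a
constant (`dist4_normalize4_mul_le`). Summed over both children this is only nonexpansive, as the
constant may equal `2`. The gain comes from a dichotomy (`IsRooting.dist4_message_le`). A child that
is prescribed, or all of whose children are prescribed, carries no error well inside the region of
agreement, and one such child already gives the factor `1 / 2`. Otherwise both children are free and
have free children; their messages are then spread out enough that `∑ c, x c * y c ≥ 1 / 20`, and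
the factor is `2 / (41 / 20) = 40 / 41`.

The bounds hold for arbitrary data on `U`, extendable to a coloring or not, so the root messages
converge everywhere as the depth grows. The limit is the required version of the conditional
marginal: the Gibbs property gives the finite-depth identity (`IsGibbsMeasure.measure_inter_eq`),
and dominated convergence passes to the limit. -/

/-! ### Estimates for one step of the recursion on four colors. -/

/-- The normalization of a nonnegative weight on the colors. -/
noncomputable def normalize4 (u : Fin 4 → ℝ) (c : Fin 4) : ℝ := u c / ∑ k, u k

/-- The `ℓ¹` distance of two weights on the colors. -/
noncomputable def dist4 (x y : Fin 4 → ℝ) : ℝ := ∑ c, |x c - y c|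

/-- Being a probability vector on the colors. -/
structure IsProb4 (x : Fin 4 → ℝ) : Prop where
  nonneg : ∀ c, 0 ≤ x c
  sum_eq : ∑ c, x c = 1

lemma IsProb4.le_one {x : Fin 4 → ℝ} (h : IsProb4 x) (c : Fin 4) : x c ≤ 1 := by
  rw [← h.sum_eq]
  exact Finset.single_le_sum (fun i _ => h.nonneg i) (Finset.mem_univ c)

lemma isProb4_single (k : Fin 4) : IsProb4 (Pi.single k 1) where
  nonneg c := by by_cases h : c = k <;> simp [h]
  sum_eq := by simp

lemma isProb4_normalize4 {u : Fin 4 → ℝ} (hu : ∀ c, 0 ≤ u c) (hs : 0 < ∑ c, u c) :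
    IsProb4 (normalize4 u) where
  nonneg c := div_nonneg (hu c) hs.le
  sum_eq := by
    unfold normalize4
    rw [← Finset.sum_div, div_self hs.ne']

lemma dist4_nonneg (x y : Fin 4 → ℝ) : 0 ≤ dist4 x y :=
  Finset.sum_nonneg fun _ _ => abs_nonneg _

lemma dist4_self (x : Fin 4 → ℝ) : dist4 x x = 0 := by simp [dist4]

lemma dist4_triangle (x y z : Fin 4 → ℝ) : dist4 x z ≤ dist4 x y + dist4 y z := by
  unfold dist4
  rw [← Finset.sum_add_distrib]
  exact Finset.sum_le_sum fun c _ => abs_sub_le _ _ _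

lemma IsProb4.dist4_le {x y : Fin 4 → ℝ} (hx : IsProb4 x) (hy : IsProb4 y) : dist4 x y ≤ 2 := by
  have : dist4 x y ≤ ∑ c, (x c + y c) := by
    refine Finset.sum_le_sum fun c _ => ?_
    have := hx.nonneg c
    have := hy.nonneg c
    rw [abs_le]
    constructor <;> linarith
  rw [Finset.sum_add_distrib, hx.sum_eq, hy.sum_eq] at this
  linarith

lemma abs_sub_le_dist4 (x y : Fin 4 → ℝ) (c : Fin 4) : |x c - y c| ≤ dist4 x y :=
  Finset.single_le_sum (f := fun c => |x c - y c|) (fun _ _ => abs_nonneg _) (Finset.mem_univ c)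

/-- The `ℓ¹` contraction estimate for multiplication by a weight followed by normalization. -/
lemma dist4_normalize4_mul_le {u u' v : Fin 4 → ℝ} (hu : ∀ c, 0 ≤ u c)
    (hv : ∀ c, 0 ≤ v c) (hv1 : ∀ c, v c ≤ 1) (hs : ∑ c, u c = ∑ c, u' c)
    (hZ : 0 < ∑ c, u c * v c) (hZ' : 0 < ∑ c, u' c * v c) :
    dist4 (normalize4 fun c => u c * v c) (normalize4 fun c => u' c * v c)
      ≤ dist4 u u' / ∑ c, u' c * v c := by
  set Z := ∑ c, u c * v c with hZdef
  set Z' := ∑ c, u' c * v c with hZ'def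
  set p : Fin 4 → ℝ := normalize4 fun c => u c * v c with hp
  set p' : Fin 4 → ℝ := normalize4 fun c => u' c * v c with hp'
  have hpp : IsProb4 p := isProb4_normalize4 (fun c => mul_nonneg (hu c) (hv c)) hZ
  -- `f` is the sign of `p - p'`, the test function attaining the `ℓ¹` distance; `m` is its mean
  -- under `p`.
  set f : Fin 4 → ℝ := fun c => if p' c ≤ p c then 1 else -1 with hf
  have hf1 : ∀ c, |f c| ≤ 1 := fun c => by
    simp only [hf]; split_ifs <;> simp
  set m : ℝ := ∑ c, p c * f c with hm
  have hm1 : |m| ≤ 1 := by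
    calc |m| ≤ ∑ c, |p c * f c| := Finset.abs_sum_le_sum_abs _ _
      _ ≤ ∑ c, p c := by
        refine Finset.sum_le_sum fun c _ => ?_
        rw [abs_mul, abs_of_nonneg (hpp.nonneg c)]
        exact mul_le_of_le_one_right (hpp.nonneg c) (hf1 c)
      _ = 1 := hpp.sum_eq
  have hpc : ∀ c, p c * Z = u c * v c := fun c => div_mul_cancel₀ _ hZ.ne'
  have hpc' : ∀ c, p' c * Z' = u' c * v c := fun c => div_mul_cancel₀ _ hZ'.ne'
  -- Since `u` and `u'` have equal mass, the constant `m` can be added to the coefficient `v c * (f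
  -- c - m)`, which could be as large as `2`. The result is a convex combination of `f c` and `m`,
  -- hence at most `1` in absolute value.
  have key : dist4 p p' * Z' = ∑ c, (u c - u' c) * (v c * f c + (1 - v c) * m) := by
    have e1 : dist4 p p' = ∑ c, f c * (p c - p' c) := by
      refine Finset.sum_congr rfl fun c _ => ?_
      simp only [hf]
      split_ifs with h
      · rw [abs_of_nonneg (by linarith)]; ring
      · rw [abs_of_nonpos (by linarith)]; ring
    have e2 : ∑ c, (u c - u' c) * (v c * f c + (1 - v c) * m)
        = ∑ c, f c * (u c * v c) - ∑ c, f c * (u' c * v c)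
          + m * (∑ c, u c - ∑ c, u' c) - m * (Z - Z') := by
      rw [hZdef, hZ'def, ← Finset.sum_sub_distrib, ← Finset.sum_sub_distrib,
        ← Finset.sum_sub_distrib, Finset.mul_sum, Finset.mul_sum, ← Finset.sum_add_distrib,
        ← Finset.sum_sub_distrib]
      exact Finset.sum_congr rfl fun c _ => by ring
    have e3 : ∑ c, f c * (u c * v c) = m * Z := by
      rw [hm, Finset.sum_mul]
      exact Finset.sum_congr rfl fun c _ => by rw [← hpc c]; ring
    rw [e2, hs, sub_self, mul_zero, add_zero, e3, e1, Finset.sum_mul]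
    have e4 : ∑ c, f c * (p c - p' c) * Z' = m * Z' - ∑ c, f c * (u' c * v c) := by
      rw [hm, Finset.sum_mul, ← Finset.sum_sub_distrib]
      exact Finset.sum_congr rfl fun c _ => by rw [← hpc' c]; ring
    rw [e4]
    ring
  rw [le_div_iff₀ hZ', key]
  refine Finset.sum_le_sum fun c _ => ?_
  have hb : |v c * f c + (1 - v c) * m| ≤ 1 := by
    have h1 := abs_le.1 (hf1 c)
    have h2 := abs_le.1 hm1
    have h3 := hv c
    have h4 := hv1 c
    rw [abs_le]
    constructor <;> nlinarith
  calc (u c - u' c) * (v c * f c + (1 - v c) * m)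
      ≤ |(u c - u' c) * (v c * f c + (1 - v c) * m)| := le_abs_self _
    _ = |u c - u' c| * |v c * f c + (1 - v c) * m| := abs_mul _ _
    _ ≤ |u c - u' c| := mul_le_of_le_one_right (abs_nonneg _) hb

lemma dist4_one_sub (x y : Fin 4 → ℝ) :
    dist4 (fun c => 1 - x c) (fun c => 1 - y c) = dist4 x y := by
  unfold dist4
  refine Finset.sum_congr rfl fun c _ => ?_
  rw [abs_sub_comm]
  congr 1
  ring

/-- Replacing one message by another in a normalized product. -/
lemma dist4_normalize4_one_sub_mul_le {x x' v : Fin 4 → ℝ} (hx : IsProb4 x) (hx' : IsProb4 x')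
    (hv : ∀ c, 0 ≤ v c) (hv1 : ∀ c, v c ≤ 1) {z : ℝ} (hz : 0 < z)
    (hZ : z ≤ ∑ c, (1 - x c) * v c) (hZ' : z ≤ ∑ c, (1 - x' c) * v c) :
    dist4 (normalize4 fun c => (1 - x c) * v c) (normalize4 fun c => (1 - x' c) * v c)
      ≤ dist4 x x' / z := by
  have h := dist4_normalize4_mul_le (u := fun c => 1 - x c) (u' := fun c => 1 - x' c) (v := v)
    (fun c => sub_nonneg.2 (hx.le_one c)) hv hv1
    (by simp [Finset.sum_sub_distrib, hx.sum_eq, hx'.sum_eq]) (hz.trans_le hZ) (hz.trans_le hZ')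
  rw [dist4_one_sub] at h
  exact h.trans (div_le_div_of_nonneg_left (dist4_nonneg _ _) hz hZ')

lemma sum_one_sub_mul_one_sub {x y : Fin 4 → ℝ} (hx : IsProb4 x) (hy : IsProb4 y) :
    ∑ c, (1 - x c) * (1 - y c) = 2 + ∑ c, x c * y c := by
  have h : ∀ c, (1 - x c) * (1 - y c) = 1 - x c - y c + x c * y c := fun c => by ring
  simp only [h, Finset.sum_add_distrib, Finset.sum_sub_distrib, hx.sum_eq, hy.sum_eq]
  simp
  norm_num

lemma sum_mul_nonneg {x y : Fin 4 → ℝ} (hx : IsProb4 x) (hy : IsProb4 y) :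
    0 ≤ ∑ c, x c * y c :=
  Finset.sum_nonneg fun c _ => mul_nonneg (hx.nonneg c) (hy.nonneg c)

/-- Pointwise the product is at least `1 - x c - y c - z c`, and these four bounds sum to `4 - 3`.
-/
lemma one_le_sum_one_sub_mul_mul {x y z : Fin 4 → ℝ} (hx : IsProb4 x) (hy : IsProb4 y)
    (hz : IsProb4 z) : 1 ≤ ∑ c, (1 - x c) * ((1 - y c) * (1 - z c)) := by
  have h : ∀ c, 1 - x c - y c - z c ≤ (1 - x c) * ((1 - y c) * (1 - z c)) := fun c => by
    have h1 := hx.nonneg c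
    have h2 := hy.nonneg c
    have h3 := hz.nonneg c
    have h4 := hx.le_one c
    have h5 := hy.le_one c
    have h6 := hz.le_one c
    have h7 : 1 - y c - z c ≤ (1 - y c) * (1 - z c) := by nlinarith
    have h8 : (1 - y c) * (1 - z c) ≤ 1 := by nlinarith
    nlinarith [mul_nonneg h1 (sub_nonneg.2 h8)]
  refine le_trans ?_ (Finset.sum_le_sum fun c _ => h c)
  simp only [Finset.sum_sub_distrib, hx.sum_eq, hy.sum_eq, hz.sum_eq]
  norm_num

/-- The numerator is at most `1` and the normalizing constant at least `2`. -/
lemma normalize4_pair_le_half {x y : Fin 4 → ℝ} (hx : IsProb4 x) (hy : IsProb4 y) (c : Fin 4) :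
    normalize4 (fun c => (1 - x c) * (1 - y c)) c ≤ 1 / 2 := by
  unfold normalize4
  rw [sum_one_sub_mul_one_sub hx hy]
  have h0 := sum_mul_nonneg hx hy
  rw [div_le_div_iff₀ (by linarith) (by norm_num)]
  have h1 := hx.nonneg c
  have h2 := hy.nonneg c
  have h3 := hx.le_one c
  have h4 := hy.le_one c
  nlinarith

/-- A message with two children, one of which has all its entries at most `1 / 2`, has all
entries at least `1 / 10`, with the exception of at most one color. -/
lemma exists_forall_le_normalize4_pair {a b : Fin 4 → ℝ} (ha : IsProb4 a) (hb : IsProb4 b)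
    (ha2 : ∀ c, a c ≤ 1 / 2) :
    ∃ f, ∀ c, c ≠ f → 1 / 10 ≤ normalize4 (fun c => (1 - a c) * (1 - b c)) c := by
  -- The exceptional color is a most likely color of `b`; every other color has `b c ≤ 1 / 2`. There
  -- the numerator is at least `1 / 4`, and the denominator is at most `2 + 1 / 2`.
  obtain ⟨f, -, hf⟩ := Finset.exists_max_image Finset.univ b ⟨0, Finset.mem_univ _⟩
  refine ⟨f, fun c hc => ?_⟩
  have hbc : b c ≤ 1 / 2 := by
    have h1 := hf c (Finset.mem_univ c)
    have h2 : ∑ k ∈ ({c, f} : Finset (Fin 4)), b k ≤ ∑ k, b k :=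
      Finset.sum_le_sum_of_subset_of_nonneg (Finset.subset_univ _) fun i _ _ => hb.nonneg i
    rw [Finset.sum_pair hc, hb.sum_eq] at h2
    linarith
  unfold normalize4
  rw [sum_one_sub_mul_one_sub ha hb]
  have h0 := sum_mul_nonneg ha hb
  have h3 : ∑ c, a c * b c ≤ 1 / 2 := by
    calc ∑ c, a c * b c ≤ ∑ c, 1 / 2 * b c :=
          Finset.sum_le_sum fun c _ => mul_le_mul_of_nonneg_right (ha2 c) (hb.nonneg c)
      _ = 1 / 2 := by rw [← Finset.mul_sum, hb.sum_eq, mul_one]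
  rw [div_le_div_iff₀ (by norm_num) (by linarith)]
  have := ha2 c
  nlinarith

/-- At least half of the mass of `y` lies off the exceptional color, where `x` is at least `1 / 10`.
-/
lemma le_sum_mul_of_forall_le {x y : Fin 4 → ℝ} (hx : IsProb4 x) (hy : IsProb4 y)
    (hx2 : ∃ f, ∀ c, c ≠ f → 1 / 10 ≤ x c) (hy2 : ∀ c, y c ≤ 1 / 2) :
    1 / 20 ≤ ∑ c, x c * y c := by
  obtain ⟨f, hf⟩ := hx2
  have h1 : ∀ c, 1 / 10 * (y c - if c = f then y f else 0) ≤ x c * y c := fun c => by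
    split_ifs with h
    · subst h
      simpa using mul_nonneg (hx.nonneg c) (hy.nonneg c)
    · rw [sub_zero]
      exact mul_le_mul_of_nonneg_right (hf c h) (hy.nonneg c)
  refine le_trans ?_ (Finset.sum_le_sum fun c _ => h1 c)
  rw [← Finset.mul_sum, Finset.sum_sub_distrib, hy.sum_eq]
  simp
  linarith [hy2 f]

/-- The two-children step in the `ℓ¹` distance. -/
lemma dist4_normalize4_pair_le {x x' y y' : Fin 4 → ℝ} (hx : IsProb4 x) (hx' : IsProb4 x')
    (hy : IsProb4 y) (hy' : IsProb4 y') {z : ℝ} (hz : 0 < z) (h1 : z ≤ ∑ c, (1 - x c) * (1 - y c))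
    (h2 : z ≤ ∑ c, (1 - x' c) * (1 - y c)) (h3 : z ≤ ∑ c, (1 - x' c) * (1 - y' c)) :
    dist4 (normalize4 fun c => (1 - x c) * (1 - y c)) (normalize4 fun c => (1 - x' c) * (1 - y' c))
      ≤ (dist4 x x' + dist4 y y') / z := by
  -- The messages are replaced one at a time through the intermediate pair `(x', y)`, which is why
  -- `h2` is needed.
  have e1 := dist4_normalize4_one_sub_mul_le (v := fun c => 1 - y c) hx hx'
    (fun c => sub_nonneg.2 (hy.le_one c)) (fun c => by linarith [hy.nonneg c]) hz h1 h2
  have e2 := dist4_normalize4_one_sub_mul_le (v := fun c => 1 - x' c) hy hy'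
    (fun c => sub_nonneg.2 (hx'.le_one c)) (fun c => by linarith [hx'.nonneg c]) hz
    (by simpa only [mul_comm] using h2) (by simpa only [mul_comm] using h3)
  simp only [mul_comm _ (1 - x' _)] at e2
  rw [add_div]
  exact (dist4_triangle _ _ _).trans (add_le_add e1 e2)

/-- The three-children step in the `ℓ¹` distance. -/
lemma dist4_normalize4_triple_le {x x' y y' z z' : Fin 4 → ℝ} (hx : IsProb4 x) (hx' : IsProb4 x')
    (hy : IsProb4 y) (hy' : IsProb4 y') (hz : IsProb4 z) (hz' : IsProb4 z') :
    dist4 (normalize4 fun c => (1 - x c) * ((1 - y c) * (1 - z c)))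
      (normalize4 fun c => (1 - x' c) * ((1 - y' c) * (1 - z' c)))
      ≤ dist4 x x' + dist4 y y' + dist4 z z' := by
  have hv : ∀ {a b : Fin 4 → ℝ}, IsProb4 a → IsProb4 b → ∀ c, 0 ≤ (1 - a c) * (1 - b c) :=
    fun ha hb c => mul_nonneg (sub_nonneg.2 (ha.le_one c)) (sub_nonneg.2 (hb.le_one c))
  have hv1 : ∀ {a b : Fin 4 → ℝ}, IsProb4 a → IsProb4 b → ∀ c, (1 - a c) * (1 - b c) ≤ 1 :=
    fun ha hb c => mul_le_one₀ (by linarith [ha.nonneg c]) (sub_nonneg.2 (hb.le_one c))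
      (by linarith [hb.nonneg c])
  have e1 := dist4_normalize4_one_sub_mul_le hx hx' (hv hy hz) (hv1 hy hz) one_pos
    (one_le_sum_one_sub_mul_mul hx hy hz) (one_le_sum_one_sub_mul_mul hx' hy hz)
  have e2 := dist4_normalize4_one_sub_mul_le hy hy' (hv hx' hz) (hv1 hx' hz) one_pos
    (one_le_sum_one_sub_mul_mul hy hx' hz) (one_le_sum_one_sub_mul_mul hy' hx' hz)
  have e3 := dist4_normalize4_one_sub_mul_le hz hz' (hv hx' hy') (hv1 hx' hy') one_pos
    (one_le_sum_one_sub_mul_mul hz hx' hy') (one_le_sum_one_sub_mul_mul hz' hx' hy')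
  rw [div_one] at e1 e2 e3
  have r1 : ∀ a b : Fin 4 → ℝ, (fun c => (1 - a c) * ((1 - x' c) * (1 - b c)))
      = fun c => (1 - x' c) * ((1 - a c) * (1 - b c)) := fun a b => by
    funext c; ring
  have r2 : ∀ a : Fin 4 → ℝ, (fun c => (1 - a c) * ((1 - x' c) * (1 - y' c)))
      = fun c => (1 - x' c) * ((1 - y' c) * (1 - a c)) := fun a => by
    funext c; ring
  rw [r1, r1] at e2
  rw [r2, r2] at e3
  linarith [dist4_triangle (normalize4 fun c => (1 - x c) * ((1 - y c) * (1 - z c)))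
    (normalize4 fun c => (1 - x' c) * ((1 - y c) * (1 - z c)))
    (normalize4 fun c => (1 - x' c) * ((1 - y' c) * (1 - z' c))),
    dist4_triangle (normalize4 fun c => (1 - x' c) * ((1 - y c) * (1 - z c)))
    (normalize4 fun c => (1 - x' c) * ((1 - y' c) * (1 - z c)))
    (normalize4 fun c => (1 - x' c) * ((1 - y' c) * (1 - z' c)))]

/-! ### Rooting the tree at a vertex. -/

/-- The children function `ch` and the level function `lev` describe the infinite `3`-regular tree
`G` as rooted at `r`. -/
structure IsRooting {V : Type*} (G : SimpleGraph V) (r : V) (ch : V → Finset V) (lev : V → ℕ) :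
    Prop where
  lev_root : lev r = 0
  lev_child : ∀ {u w}, w ∈ ch u → lev w = lev u + 1
  card_root : (ch r).card = 3
  card_ch : ∀ {w}, w ≠ r → (ch w).card = 2
  parent_unique : ∀ {w u u'}, w ∈ ch u → w ∈ ch u' → u = u'
  exists_parent : ∀ {w}, w ≠ r → ∃ u, w ∈ ch u
  adj_iff : ∀ {u w}, G.Adj u w ↔ w ∈ ch u ∨ u ∈ ch w

/-- Geodesics from `r` to `u` and to `u'`, each extended by the edge to `w`, are paths with the same
ends, so they coincide in a tree. -/
lemma SimpleGraph.IsTree.eq_of_adj_of_dist_eq {V : Type*} {G : SimpleGraph V} (hG : G.IsTree)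
    {r w u u' : V} (hu : G.Adj u w) (hu' : G.Adj u' w) (h : G.dist r w = G.dist r u + 1)
    (h' : G.dist r w = G.dist r u' + 1) : u = u' := by
  obtain ⟨p, hp⟩ := hG.connected.exists_walk_length_eq_dist r u
  obtain ⟨p', hp'⟩ := hG.connected.exists_walk_length_eq_dist r u'
  have h1 : (p.concat hu).IsPath :=
    SimpleGraph.Walk.isPath_of_length_eq_dist _ (by rw [SimpleGraph.Walk.length_concat, hp, h])
  have h2 : (p'.concat hu').IsPath :=
    SimpleGraph.Walk.isPath_of_length_eq_dist _ (by rw [SimpleGraph.Walk.length_concat, hp', h'])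
  have h3 := (hG.isAcyclic.subsingleton_path _ _).elim ⟨_, h1⟩ ⟨_, h2⟩
  obtain ⟨h4, -⟩ := SimpleGraph.Walk.concat_inj (congrArg Subtype.val h3)
  exact h4

lemma SimpleGraph.IsTree.exists_adj_dist_eq {V : Type*} {G : SimpleGraph V} (hG : G.IsTree)
    {r w : V} (hw : w ≠ r) : ∃ u, G.Adj u w ∧ G.dist r w = G.dist r u + 1 := by
  obtain ⟨p, hp⟩ := hG.connected.exists_walk_length_eq_dist w r
  cases p with
  | nil => exact absurd rfl hw
  | cons h q =>
    refine ⟨_, h.symm, ?_⟩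
    have h1 := SimpleGraph.dist_le q
    rw [SimpleGraph.Walk.length_cons] at hp
    rw [SimpleGraph.dist_comm] at hp h1
    rcases hG.dist_eq_dist_add_one_of_adj r h with h2 | h2 <;> omega

/-- Children are the neighbors farther from `r`. Adjacent vertices never have equal distance to `r`,
and a vertex other than `r` has exactly one nearer neighbor, so two of its three neighbors are
children. -/
lemma IsCayleyTree.exists_isRooting {V : Type*} {G : SimpleGraph V} (hG : IsCayleyTree 2 G)
    (r : V) : ∃ ch : V → Finset V, IsRooting G r ch (G.dist r) := by
  classical
  have hT := hG.isTree
  have hcard : ∀ v, (G.neighborSet v).encard = 3 := fun v => by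
    rw [hG.regular v]; norm_num
  have hfin : ∀ v, (G.neighborSet v).Finite := fun v =>
    Set.finite_of_encard_eq_coe (k := 3) (hcard v)
  have hN : ∀ v, (hfin v).toFinset.card = 3 := fun v => by
    have h1 := hcard v
    rw [(hfin v).encard_eq_coe_toFinset_card] at h1
    exact_mod_cast h1
  let ch : V → Finset V := fun u => (hfin u).toFinset.filter fun w => G.dist r w = G.dist r u + 1
  have hch : ∀ {u w}, w ∈ ch u ↔ G.Adj u w ∧ G.dist r w = G.dist r u + 1 := by
    intro u w
    simp [ch]
  refine ⟨ch, ?_⟩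
  refine
    { lev_root := G.dist_self
      lev_child := fun h => (hch.1 h).2
      card_root := ?_
      card_ch := ?_
      parent_unique := fun h h' =>
        hT.eq_of_adj_of_dist_eq (hch.1 h).1 (hch.1 h').1 (hch.1 h).2 (hch.1 h').2
      exists_parent := fun hw => by
        obtain ⟨u, h1, h2⟩ := hT.exists_adj_dist_eq hw
        exact ⟨u, hch.2 ⟨h1, h2⟩⟩
      adj_iff := ?_ }
  · rw [← hN r]
    congr 1
    refine Finset.filter_true_of_mem fun w hw => ?_
    have h1 : G.Adj r w := by simpa using hw
    rw [SimpleGraph.dist_self, SimpleGraph.dist_eq_one_iff_adj.2 h1]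
  · intro w hw
    obtain ⟨u, h1, h2⟩ := hT.exists_adj_dist_eq hw
    have h3 : ch w = (hfin w).toFinset.erase u := by
      ext x
      rw [hch, Finset.mem_erase, Set.Finite.mem_toFinset, SimpleGraph.mem_neighborSet]
      constructor
      · rintro ⟨h4, h5⟩
        refine ⟨?_, h4⟩
        rintro rfl
        omega
      · rintro ⟨h4, h5⟩
        refine ⟨h5, ?_⟩
        rcases hT.dist_eq_dist_add_one_of_adj r h5 with h6 | h6
        · exact absurd (hT.eq_of_adj_of_dist_eq h5.symm h1 h6 h2) h4
        · exact h6
    rw [h3, Finset.card_erase_of_mem (by simpa using h1.symm), hN]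
  · intro u w
    rw [hch, hch]
    constructor
    · intro h
      rcases hT.dist_eq_dist_add_one_of_adj r h with h1 | h1
      · exact Or.inr ⟨h.symm, h1⟩
      · exact Or.inl ⟨h, h1⟩
    · rintro (h | h)
      · exact h.1
      · exact h.1.symm

/-! ### Messages and their decay of correlation. -/

open scoped Classical in
/-- The message of the vertex `w` after `n` rounds of the sum-product recursion: the marginal at
`w` of the uniform coloring of the first `n` levels of the branch at `w`, given that the colors on
`U` and on the last level are those of `ζ`. -/
noncomputable def message {V : Type*} (ch : V → Finset V) (U : Set V) (ζ : V → Fin 4) :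
    ℕ → V → Fin 4 → ℝ
  | 0, w => Pi.single (ζ w) 1
  | n + 1, w => if w ∈ U then Pi.single (ζ w) 1 else
      normalize4 fun c => ∏ i ∈ ch w, (1 - message ch U ζ n i c)

section Message

variable {V : Type*} {G : SimpleGraph V} {r : V} {ch : V → Finset V} {lev : V → ℕ} {U : Set V}

lemma message_of_mem {w : V} (hw : w ∈ U) (ζ : V → Fin 4) (n : ℕ) :
    message ch U ζ n w = Pi.single (ζ w) 1 := by
  cases n <;> simp [message, hw]

lemma message_succ {w : V} (hw : w ∉ U) (ζ : V → Fin 4) (n : ℕ) :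
    message ch U ζ (n + 1) w = normalize4 fun c => ∏ i ∈ ch w, (1 - message ch U ζ n i c) := by
  simp [message, hw]

/-- The normalizing constant never vanishes, whatever the data `ζ`; this is what makes every message
a probability vector. -/
lemma IsRooting.one_le_sum_prod (hr : IsRooting G r ch lev) {m : V → Fin 4 → ℝ}
    (hm : ∀ w, IsProb4 (m w)) (w : V) : 1 ≤ ∑ c, ∏ i ∈ ch w, (1 - m i c) := by
  classical
  by_cases h : w = r
  · subst h
    obtain ⟨x, y, z, hxy, hxz, hyz, h⟩ := Finset.card_eq_three.1 hr.card_root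
    have e : ∀ c, ∏ i ∈ ch w, (1 - m i c) = (1 - m x c) * ((1 - m y c) * (1 - m z c)) := fun c => by
      rw [h, Finset.prod_insert (by simp [hxy, hxz]), Finset.prod_pair hyz]
    simp only [e]
    exact one_le_sum_one_sub_mul_mul (hm x) (hm y) (hm z)
  · obtain ⟨x, y, hxy, h⟩ := Finset.card_eq_two.1 (hr.card_ch h)
    have e : ∀ c, ∏ i ∈ ch w, (1 - m i c) = (1 - m x c) * (1 - m y c) := fun c => by
      rw [h, Finset.prod_pair hxy]
    simp only [e]
    rw [sum_one_sub_mul_one_sub (hm x) (hm y)]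
    linarith [sum_mul_nonneg (hm x) (hm y)]

lemma IsRooting.isProb4_message (hr : IsRooting G r ch lev) (ζ : V → Fin 4) (n : ℕ) (w : V) :
    IsProb4 (message ch U ζ n w) := by
  induction n generalizing w with
  | zero => exact isProb4_single _
  | succ n ih =>
    by_cases hw : w ∈ U
    · rw [message_of_mem hw]
      exact isProb4_single _
    · rw [message_succ hw]
      refine isProb4_normalize4 (fun c => ?_) (one_pos.trans_le (hr.one_le_sum_prod ih w))
      exact Finset.prod_nonneg fun i _ => sub_nonneg.2 ((ih i).le_one c)

lemma IsRooting.exists_message_succ_eq (hr : IsRooting G r ch lev) {w : V} (hw : w ≠ r) :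
    ∃ i j, i ∈ ch w ∧ j ∈ ch w ∧ (∀ x ∈ ch w, x = i ∨ x = j) ∧ (w ∉ U → ∀ (ζ : V → Fin 4) (n : ℕ),
      message ch U ζ (n + 1) w =
        normalize4 fun c => (1 - message ch U ζ n i c) * (1 - message ch U ζ n j c)) := by
  classical
  obtain ⟨i, j, hij, h⟩ := Finset.card_eq_two.1 (hr.card_ch hw)
  refine ⟨i, j, by simp [h], by simp [h], by simp [h], fun hU ζ n => ?_⟩
  rw [message_succ hU, h]
  congr 1
  funext c
  rw [Finset.prod_pair hij]

lemma IsRooting.message_le_half (hr : IsRooting G r ch lev) (ζ : V → Fin 4) {n : ℕ} (hn : n ≠ 0)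
    {w : V} (hw : w ≠ r) (hU : w ∉ U) (c : Fin 4) : message ch U ζ n w c ≤ 1 / 2 := by
  obtain ⟨n, rfl⟩ := Nat.exists_eq_succ_of_ne_zero hn
  obtain ⟨i, j, -, -, -, h⟩ := hr.exists_message_succ_eq (U := U) hw
  rw [h hU]
  exact normalize4_pair_le_half (hr.isProb4_message _ _ _) (hr.isProb4_message _ _ _) c

lemma IsRooting.ne_root (hr : IsRooting G r ch lev) {u w : V} (h : w ∈ ch u) : w ≠ r := by
  rintro rfl
  have := hr.lev_child h
  rw [hr.lev_root] at this
  omega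

/-- A free vertex with a free child receives a message bounded below off one color. -/
lemma IsRooting.exists_forall_le_message (hr : IsRooting G r ch lev) (ζ : V → Fin 4) {n : ℕ}
    (hn : n ≠ 0) {w i : V} (hw : w ≠ r) (hU : w ∉ U) (hi : i ∈ ch w) (hiU : i ∉ U) :
    ∃ f, ∀ c, c ≠ f → 1 / 10 ≤ message ch U ζ (n + 1) w c := by
  obtain ⟨j, k, hj, hk, hjk, h⟩ := hr.exists_message_succ_eq (U := U) hw
  rw [h hU]
  rcases hjk _ hi with rfl | rfl
  · exact exists_forall_le_normalize4_pair (hr.isProb4_message _ _ _) (hr.isProb4_message _ _ _)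
      (hr.message_le_half ζ hn (hr.ne_root hj) hiU)
  · simp only [mul_comm (1 - message ch U ζ n j _)]
    exact exists_forall_le_normalize4_pair (hr.isProb4_message _ _ _) (hr.isProb4_message _ _ _)
      (hr.message_le_half ζ hn (hr.ne_root hk) hiU)

/-- Decay of correlation for the messages: boundary data that agree on the part of `U` of level
below `d` give messages that are exponentially close. -/
lemma IsRooting.dist4_message_le (hr : IsRooting G r ch lev) {ζ ζ' : V → Fin 4} {d : ℕ}
    (hζ : ∀ u ∈ U, lev u < d → ζ u = ζ' u) (k : ℕ) {n n' : ℕ} (hn : k ≤ n) (hn' : k ≤ n') {w : V}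
    (hw : w ≠ r) (hd : lev w + k ≤ d) :
    dist4 (message ch U ζ n w) (message ch U ζ' n' w) ≤ 4 * (40 / 41) ^ k := by
  induction k generalizing n n' w with
  | zero =>
    refine ((hr.isProb4_message _ _ _).dist4_le (hr.isProb4_message _ _ _)).trans (by norm_num)
  | succ k ih =>
    have hq : (0 : ℝ) ≤ 4 * (40 / 41) ^ k := by positivity
    by_cases hU : w ∈ U
    · rw [message_of_mem hU, message_of_mem hU, hζ w hU (by omega), dist4_self]
      positivity
    -- The contraction step looks two levels below `w` and needs three rounds, so that the
    -- grandchildren's messages are not initial point masses. For fewer rounds the trivial bound `2`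
    -- suffices, which the constant `4` leaves room for.
    rcases Nat.lt_or_ge k 2 with hk | hk
    · refine ((hr.isProb4_message _ _ _).dist4_le (hr.isProb4_message _ _ _)).trans ?_
      interval_cases k <;> norm_num
    obtain ⟨n, rfl⟩ : ∃ m, n = m + 1 + 1 := ⟨n - 2, by omega⟩
    obtain ⟨n', rfl⟩ : ∃ m, n' = m + 1 + 1 := ⟨n' - 2, by omega⟩
    obtain ⟨i, j, hi, hj, -, h⟩ := hr.exists_message_succ_eq (U := U) hw
    have li := hr.lev_child hi
    have lj := hr.lev_child hj
    have Di := ih (n := n + 1) (n' := n' + 1) (by omega) (by omega) (hr.ne_root hi) (by omega)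
    have Dj := ih (n := n + 1) (n' := n' + 1) (by omega) (by omega) (hr.ne_root hj) (by omega)
    have pi : ∀ ζ n, IsProb4 (message ch U ζ n i) := fun ζ n => hr.isProb4_message ζ n i
    have pj : ∀ ζ n, IsProb4 (message ch U ζ n j) := fun ζ n => hr.isProb4_message ζ n j
    rw [h hU, h hU, pow_succ]
    have two : ∀ {x y : Fin 4 → ℝ}, IsProb4 x → IsProb4 y → 2 ≤ ∑ c, (1 - x c) * (1 - y c) :=
      fun hx hy => by
        rw [sum_one_sub_mul_one_sub hx hy]
        linarith [sum_mul_nonneg hx hy]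
    have half := dist4_normalize4_pair_le (pi ζ (n + 1)) (pi ζ' (n' + 1)) (pj ζ (n + 1))
      (pj ζ' (n' + 1)) two_pos (two (pi _ _) (pj _ _)) (two (pi _ _) (pj _ _))
      (two (pi _ _) (pj _ _))
    -- a child is inert when it is prescribed or all its children are
    have active : ∀ x ∈ ch w, dist4 (message ch U ζ (n + 1) x) (message ch U ζ' (n' + 1) x) ≠ 0 →
        x ∉ U ∧ ∃ y ∈ ch x, y ∉ U := by
      intro x hx h0
      have lx := hr.lev_child hx
      constructor
      · intro hxU
        refine h0 ?_
        rw [message_of_mem hxU, message_of_mem hxU, hζ x hxU (by omega), dist4_self]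
      · by_contra! hall
        refine h0 ?_
        by_cases hxU : x ∈ U
        · rw [message_of_mem hxU, message_of_mem hxU, hζ x hxU (by omega), dist4_self]
        rw [message_succ hxU, message_succ hxU]
        have e : ∀ y ∈ ch x, message ch U ζ n y = message ch U ζ' n' y := fun y hy => by
          have ly := hr.lev_child hy
          rw [message_of_mem (hall y hy), message_of_mem (hall y hy), hζ y (hall y hy) (by omega)]
        have e2 : (fun c => ∏ y ∈ ch x, (1 - message ch U ζ n y c))
            = fun c => ∏ y ∈ ch x, (1 - message ch U ζ' n' y c) := by
          funext c
          exact Finset.prod_congr rfl fun y hy => by rw [e y hy]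
        rw [e2, dist4_self]
    -- With one inert child, only one error term remains over a constant at least `2`.
    by_cases h1 : dist4 (message ch U ζ (n + 1) i) (message ch U ζ' (n' + 1) i) = 0
    · rw [h1] at half
      linarith
    by_cases h2 : dist4 (message ch U ζ (n + 1) j) (message ch U ζ' (n' + 1) j) = 0
    · rw [h2] at half
      linarith
    obtain ⟨hiU, y, hy, hyU⟩ := active i hi h1
    obtain ⟨hjU, -⟩ := active j hj h2
    -- Both children are free and `i` has a free child `y`: the message of `i` is at least `1 / 10`
    -- off one color, that of `j` is at most `1 / 2`, so the normalizing constant gains `1 / 20`.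
    -- The two boundary data may differ because the hybrid pair occurs as well.
    have big : ∀ ζ ζ' (m m' : ℕ), m ≠ 0 → 41 / 20 ≤
        ∑ c, (1 - message ch U ζ (m + 1) i c) * (1 - message ch U ζ' (m' + 1) j c) := by
      intro ζ ζ' m m' hm
      rw [sum_one_sub_mul_one_sub (pi _ _) (pj _ _)]
      linarith [le_sum_mul_of_forall_le (pi ζ (m + 1)) (pj ζ' (m' + 1))
        (hr.exists_forall_le_message ζ hm (hr.ne_root hi) hiU hy hyU)
        (hr.message_le_half ζ' (by omega) (hr.ne_root hj) hjU)]
    have hn0 : n ≠ 0 := by omega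
    have hn0' : n' ≠ 0 := by omega
    have fin := dist4_normalize4_pair_le (pi ζ (n + 1)) (pi ζ' (n' + 1)) (pj ζ (n + 1))
      (pj ζ' (n' + 1)) (z := 41 / 20) (by norm_num) (big _ _ _ _ hn0) (big _ _ _ _ hn0')
      (big _ _ _ _ hn0')
    linarith

/-- Decay of correlation at the root. -/
lemma IsRooting.dist4_message_root_le (hr : IsRooting G r ch lev) {ζ ζ' : V → Fin 4} {d : ℕ}
    (hrU : r ∉ U) (hζ : ∀ u ∈ U, lev u < d → ζ u = ζ' u) (k : ℕ) {n n' : ℕ} (hn : k ≤ n)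
    (hn' : k ≤ n') (hd : k ≤ d) :
    dist4 (message ch U ζ n r) (message ch U ζ' n' r) ≤ 13 * (40 / 41) ^ k := by
  classical
  cases k with
  | zero =>
    refine ((hr.isProb4_message _ _ _).dist4_le (hr.isProb4_message _ _ _)).trans (by norm_num)
  | succ k =>
    obtain ⟨n, rfl⟩ : ∃ m, n = m + 1 := ⟨n - 1, by omega⟩
    obtain ⟨n', rfl⟩ : ∃ m, n' = m + 1 := ⟨n' - 1, by omega⟩
    obtain ⟨x, y, z, hxy, hxz, hyz, h⟩ := Finset.card_eq_three.1 hr.card_root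
    have e : ∀ ζ n, message ch U ζ (n + 1) r = normalize4 fun c => (1 - message ch U ζ n x c)
        * ((1 - message ch U ζ n y c) * (1 - message ch U ζ n z c)) := fun ζ n => by
      rw [message_succ hrU]
      congr 1
      funext c
      rw [h, Finset.prod_insert (by simp [hxy, hxz]), Finset.prod_pair hyz]
    have D : ∀ i ∈ ch r, dist4 (message ch U ζ n i) (message ch U ζ' n' i) ≤ 4 * (40 / 41) ^ k :=
      fun i hi => hr.dist4_message_le hζ k (by omega) (by omega) (hr.ne_root hi) (by
        rw [hr.lev_child hi, hr.lev_root]; omega)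
    have hp : ∀ ζ n i, IsProb4 (message ch U ζ n i) := fun ζ n i => hr.isProb4_message ζ n i
    have main := dist4_normalize4_triple_le (hp ζ n x) (hp ζ' n' x) (hp ζ n y) (hp ζ' n' y)
      (hp ζ n z) (hp ζ' n' z)
    have D1 := D x (by simp [h])
    have D2 := D y (by simp [h])
    have D3 := D z (by simp [h])
    -- The root step is only Lipschitz, with three children: `3 * 4 * (40 / 41) ^ k` is `12.3 * (40
    -- / 41) ^ (k + 1)`, whence the `13`.
    have hq : (0 : ℝ) ≤ (40 / 41) ^ k := by positivity
    rw [e, e, pow_succ]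
    linarith

end Message

/-! ### Sums over recolorings of a finite set. -/

/-- The sum of `F` over all recolorings of `ζ` on the finite set `A`. -/
noncomputable def sumRecolor {V : Type*} [DecidableEq V] (A : Finset V) (F : (V → Fin 4) → ℝ)
    (ζ : V → Fin 4) : ℝ :=
  ∑ η : A → Fin 4, F (Function.updateFinset ζ A η)

section SumRecolor

variable {V : Type*} [DecidableEq V]

lemma updateFinset_of_notMem {A : Finset V} {ζ : V → Fin 4} {η : A → Fin 4} {w : V}
    (hw : w ∉ A) : Function.updateFinset ζ A η w = ζ w := by
  simp [Function.updateFinset, hw]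

lemma sumRecolor_union {A B : Finset V} (h : Disjoint A B) (F : (V → Fin 4) → ℝ)
    (ζ : V → Fin 4) : sumRecolor (A ∪ B) F ζ = sumRecolor A (sumRecolor B F) ζ := by
  unfold sumRecolor
  rw [← Fintype.sum_prod_type']
  refine (Fintype.sum_equiv (Equiv.piFinsetUnion (fun _ => Fin 4) h) _ _ fun x => ?_).symm
  rw [Function.updateFinset_updateFinset h]

/-- Distributivity: a weight that factors over the vertices of `A` can be summed vertex by vertex.
-/
lemma sumRecolor_mul_prod (A : Finset V) {F G : (V → Fin 4) → ℝ}
    {h : V → (V → Fin 4) → Fin 4 → ℝ} {ζ : V → Fin 4}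
    (hF : ∀ η : A → Fin 4, F (Function.updateFinset ζ A η) = G ζ *
      ∏ w ∈ A, h w ζ (Function.updateFinset ζ A η w)) :
    sumRecolor A F ζ = G ζ * ∏ w ∈ A, ∑ c, h w ζ c := by
  unfold sumRecolor
  simp only [hF]
  rw [← Finset.mul_sum]
  congr 1
  rw [← Finset.prod_coe_sort, Finset.prod_univ_sum, Fintype.piFinset_univ]
  refine Finset.sum_congr rfl fun η _ => ?_
  rw [← Finset.prod_coe_sort]
  refine Finset.prod_congr rfl fun w _ => ?_
  simp [Function.updateFinset]

end SumRecolor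

/-! ### Summing out the tree level by level. -/

section Levels

variable {V : Type*} [DecidableEq V] {G : SimpleGraph V} {r : V} {ch : V → Finset V} {lev : V → ℕ}

/-- The vertices of level `k`. -/
def levelSet (ch : V → Finset V) (r : V) : ℕ → Finset V
  | 0 => {r}
  | k + 1 => (levelSet ch r k).biUnion ch

lemma IsRooting.mem_levelSet (hr : IsRooting G r ch lev) {k : ℕ} {w : V} :
    w ∈ levelSet ch r k ↔ lev w = k := by
  induction k generalizing w with
  | zero =>
    rw [levelSet, Finset.mem_singleton]
    constructor
    · rintro rfl
      exact hr.lev_root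
    · intro h
      by_contra hw
      obtain ⟨u, hu⟩ := hr.exists_parent hw
      have := hr.lev_child hu
      omega
  | succ k ih =>
    rw [levelSet, Finset.mem_biUnion]
    constructor
    · rintro ⟨u, hu, hw⟩
      rw [hr.lev_child hw, ih.1 hu]
    · intro h
      have hw : w ≠ r := by
        rintro rfl
        rw [hr.lev_root] at h
        omega
      obtain ⟨u, hu⟩ := hr.exists_parent hw
      have := hr.lev_child hu
      exact ⟨u, ih.2 (by omega), hu⟩

/-- Regrouping a product over a level by parents. -/
lemma IsRooting.prod_levelSet_succ (hr : IsRooting G r ch lev) {par : V → V}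
    (hpar : ∀ {u w}, w ∈ ch u → par w = u) (k : ℕ) (q : V → V → ℝ) :
    ∏ w ∈ levelSet ch r (k + 1), q (par w) w = ∏ u ∈ levelSet ch r k, ∏ w ∈ ch u, q u w := by
  rw [levelSet, Finset.prod_biUnion]
  · exact Finset.prod_congr rfl fun u _ => Finset.prod_congr rfl fun w hw => by rw [hpar hw]
  · intro u _ u' _ hne
    rw [Function.onFun, Finset.disjoint_left]
    exact fun w h h' => hne (hr.parent_unique h h')

/-- The indicator that the edges between the first `k + 1` levels are properly colored. -/
noncomputable def properUpTo (ch : V → Finset V) (r : V) (par : V → V) (k : ℕ)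
    (ξ : V → Fin 4) : ℝ :=
  ∏ j ∈ Finset.range k, ∏ w ∈ levelSet ch r (j + 1), if ξ (par w) = ξ w then 0 else 1

lemma IsRooting.properUpTo_congr (hr : IsRooting G r ch lev) {par : V → V}
    (hpar : ∀ {u w}, w ∈ ch u → par w = u) {k : ℕ} {ξ ξ' : V → Fin 4}
    (h : ∀ w, lev w ≤ k → ξ w = ξ' w) :
    properUpTo ch r par k ξ = properUpTo ch r par k ξ' := by
  unfold properUpTo
  refine Finset.prod_congr rfl fun j hj => Finset.prod_congr rfl fun w hw => ?_
  rw [Finset.mem_range] at hj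
  obtain ⟨u, hu, huw⟩ := Finset.mem_biUnion.1 hw
  rw [hr.mem_levelSet] at hu hw
  rw [hpar huw, h u (by omega), h w (by omega)]

/-- The weight of `ξ` after the levels beyond `k` have been summed out. -/
noncomputable def peeledWeight (ch : V → Finset V) (r : V) (par : V → V) (k : ℕ)
    (m : V → Fin 4 → ℝ) (g : Fin 4 → ℝ) (ξ : V → Fin 4) : ℝ :=
  g (ξ r) * properUpTo ch r par k ξ * ∏ w ∈ levelSet ch r k, m w (ξ w)

lemma sum_ite_mul_eq {m : Fin 4 → ℝ} (hm : ∑ c, m c = 1) (k : Fin 4) :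
    ∑ c, (if k = c then 0 else 1) * m c = 1 - m k := by
  have h : ∀ c, (if k = c then 0 else 1) * m c = m c - if k = c then m c else 0 := fun c => by
    split_ifs <;> simp
  simp only [h, Finset.sum_sub_distrib, hm, Finset.sum_ite_eq, Finset.mem_univ, if_true]

/-- Summing out the free vertices of level `k + 1`. -/
lemma IsRooting.sumRecolor_level (hr : IsRooting G r ch lev) {par : V → V}
    (hpar : ∀ {u w}, w ∈ ch u → par w = u) {R : Finset V} {k : ℕ} {m : V → Fin 4 → ℝ}
    {ζ ξ : V → Fin 4} (hξ : ∀ w, lev w = k + 1 → ξ w = ζ w)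
    (hm : ∀ w, lev w = k + 1 → ∑ c, m w c = 1)
    (hmR : ∀ w, lev w = k + 1 → w ∉ R → m w = Pi.single (ζ w) 1) (g : Fin 4 → ℝ) :
    sumRecolor (R.filter fun w => lev w = k + 1) (peeledWeight ch r par (k + 1) m g) ξ
      = g (ξ r) * properUpTo ch r par k ξ *
        ∏ u ∈ levelSet ch r k, ∏ w ∈ ch u, (1 - m w (ξ u)) := by
  set A := R.filter fun w => lev w = k + 1 with hA
  have hAL : A ⊆ levelSet ch r (k + 1) := fun w hw =>
    hr.mem_levelSet.2 (Finset.mem_filter.1 hw).2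
  have hpl : ∀ w ∈ levelSet ch r (k + 1), lev (par w) = k := fun w hw => by
    obtain ⟨u, hu, huw⟩ := Finset.mem_biUnion.1 hw
    rw [hpar huw, hr.mem_levelSet.1 hu]
  rw [← hr.prod_levelSet_succ hpar k fun u w => 1 - m w (ξ u)]
  rw [sumRecolor_mul_prod A
    (G := fun ξ => g (ξ r) * properUpTo ch r par k ξ *
      ∏ w ∈ levelSet ch r (k + 1) \ A, (1 - m w (ξ (par w))))
    (h := fun w ξ c => (if ξ (par w) = c then 0 else 1) * m w c)]
  · have e : ∀ w ∈ A, (∑ c, (if ξ (par w) = c then 0 else 1) * m w c) = 1 - m w (ξ (par w)) :=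
      fun w hw => sum_ite_mul_eq (hm w (Finset.mem_filter.1 hw).2) _
    rw [Finset.prod_congr rfl e, mul_assoc (g (ξ r) * _), Finset.prod_sdiff hAL]
  · intro η
    have low : ∀ w, lev w ≤ k → Function.updateFinset ξ A η w = ξ w := fun w hw =>
      updateFinset_of_notMem fun h => by
        have := (Finset.mem_filter.1 h).2
        omega
    unfold peeledWeight
    have e0 : properUpTo ch r par (k + 1) (Function.updateFinset ξ A η)
        = properUpTo ch r par k ξ * ∏ w ∈ levelSet ch r (k + 1),
          if ξ (par w) = Function.updateFinset ξ A η w then 0 else 1 := by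
      rw [← hr.properUpTo_congr hpar low]
      rw [properUpTo, Finset.prod_range_succ, ← properUpTo]
      congr 1
      exact Finset.prod_congr rfl fun w hw => by rw [low _ (hpl w hw).le]
    rw [e0, low r (by rw [hr.lev_root]; omega), mul_assoc, mul_assoc, ← Finset.prod_mul_distrib,
      ← Finset.prod_sdiff hAL, mul_assoc, mul_assoc]
    congr 2
    congr 1
    -- A prescribed vertex contributes the properness indicator of its parent edge, which equals `1
    -- - m w` at the parent's color because `m w` is a point mass; it thus has the same form as a
    -- summed-out free vertex.
    refine Finset.prod_congr rfl fun w hw => ?_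
    obtain ⟨hw1, hw2⟩ := Finset.mem_sdiff.1 hw
    have hl := hr.mem_levelSet.1 hw1
    have hwR : w ∉ R := fun h => hw2 (Finset.mem_filter.2 ⟨h, hl⟩)
    rw [updateFinset_of_notMem hw2, hξ w hl, hmR w hl hwR, Pi.single_eq_same, mul_one,
      Pi.single_apply]
    split_ifs <;> simp

/-- One round of the sum-product recursion. -/
lemma IsRooting.exists_sumRecolor_succ_eq (hr : IsRooting G r ch lev) {par : V → V}
    (hpar : ∀ {u w}, w ∈ ch u → par w = u) {R : Finset V} {k : ℕ} {m m' : V → Fin 4 → ℝ}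
    {ζ : V → Fin 4} (hm : ∀ w, IsProb4 (m w))
    (hmR : ∀ w, lev w = k + 1 → w ∉ R → m w = Pi.single (ζ w) 1)
    (hm'R : ∀ w, lev w = k → w ∉ R → m' w = Pi.single (ζ w) 1)
    (hm' : ∀ w, lev w = k → w ∈ R → m' w = normalize4 fun c => ∏ i ∈ ch w, (1 - m i c)) :
    ∃ K, ∀ g, sumRecolor (R.filter fun w => lev w ≤ k + 1) (peeledWeight ch r par (k + 1) m g) ζ
      = K * sumRecolor (R.filter fun w => lev w ≤ k) (peeledWeight ch r par k m' g) ζ := by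
  classical
  have hsplit : (R.filter fun w => lev w ≤ k + 1)
      = (R.filter fun w => lev w ≤ k) ∪ R.filter fun w => lev w = k + 1 := by
    ext w
    simp only [Finset.mem_filter, Finset.mem_union]
    constructor
    · rintro ⟨h1, h2⟩
      rcases Nat.lt_or_ge k (lev w) with h | h
      · exact Or.inr ⟨h1, by omega⟩
      · exact Or.inl ⟨h1, h⟩
    · rintro (⟨h1, h2⟩ | ⟨h1, h2⟩)
      · exact ⟨h1, by omega⟩
      · exact ⟨h1, by omega⟩
  have hdisj : Disjoint (R.filter fun w => lev w ≤ k) (R.filter fun w => lev w = k + 1) := by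
    rw [Finset.disjoint_left]
    intro w h1 h2
    have h3 := (Finset.mem_filter.1 h1).2
    have h4 := (Finset.mem_filter.1 h2).2
    omega
  -- `K` collects the normalizing constants of the free vertices and the fixed factors of the
  -- prescribed ones. It does not depend on `g`, so it cancels in the marginal at the root.
  refine ⟨∏ u ∈ levelSet ch r k, if u ∈ R then ∑ c, ∏ i ∈ ch u, (1 - m i c)
    else ∏ i ∈ ch u, (1 - m i (ζ u)), fun g => ?_⟩
  rw [hsplit, sumRecolor_union hdisj]
  conv_lhs => unfold sumRecolor
  conv_rhs => unfold sumRecolor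
  rw [Finset.mul_sum]
  refine Finset.sum_congr rfl fun η _ => ?_
  set ξ := Function.updateFinset ζ (R.filter fun w => lev w ≤ k) η with hξ
  have h1 := hr.sumRecolor_level hpar (R := R) (k := k) (m := m) (ζ := ζ) (ξ := ξ)
    (fun w hw => updateFinset_of_notMem fun h => by
      have := (Finset.mem_filter.1 h).2
      omega) (fun w _ => (hm w).sum_eq) hmR g
  rw [sumRecolor] at h1
  rw [h1, peeledWeight, mul_left_comm, ← Finset.prod_mul_distrib]
  congr 1
  refine Finset.prod_congr rfl fun u hu => ?_
  have hlu := hr.mem_levelSet.1 hu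
  split_ifs with h
  · rw [hm' u hlu h, normalize4, mul_div_cancel₀]
    exact (one_pos.trans_le (hr.one_le_sum_prod hm u)).ne'
  · have : ξ u = ζ u := updateFinset_of_notMem fun h' => h (Finset.mem_filter.1 h').1
    rw [hm'R u hlu h, this, Pi.single_eq_same, mul_one]

/-- The sum-product algorithm computes the marginal at the root. -/
lemma IsRooting.exists_sumRecolor_eq (hr : IsRooting G r ch lev) {par : V → V}
    (hpar : ∀ {u w}, w ∈ ch u → par w = u) {U : Set V} (hrU : r ∉ U) {n : ℕ} {R : Finset V}
    (hR : ∀ w, w ∈ R ↔ lev w ≤ n ∧ w ∉ U) (ζ : V → Fin 4) :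
    ∃ K, ∀ g : Fin 4 → ℝ, sumRecolor R (fun ξ => g (ξ r) * properUpTo ch r par (n + 1) ξ) ζ
      = K * ∑ c, g c * message ch U ζ (n + 1) r c := by
  -- After `j` levels are peeled off, level `k = n + 1 - j` carries the messages of `j` rounds.
  have step : ∀ j k, k + j = n + 1 → ∃ K, ∀ g, sumRecolor (R.filter fun w => lev w ≤ n + 1)
      (peeledWeight ch r par (n + 1) (message ch U ζ 0) g) ζ = K *
      sumRecolor (R.filter fun w => lev w ≤ k) (peeledWeight ch r par k (message ch U ζ j) g) ζ := by
    intro j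
    induction j with
    | zero =>
      rintro k rfl
      exact ⟨1, fun g => by rw [one_mul]⟩
    | succ j ih =>
      intro k hk
      obtain ⟨K, hK⟩ := ih (k + 1) (by omega)
      obtain ⟨K', hK'⟩ := hr.exists_sumRecolor_succ_eq hpar (R := R) (k := k)
        (m := message ch U ζ j) (m' := message ch U ζ (j + 1)) (ζ := ζ)
        (fun w => hr.isProb4_message ζ j w) (fun w hw hwR => by
          by_cases hU : w ∈ U
          · exact message_of_mem hU ζ j
          -- A vertex outside both `R` and `U` lies beyond level `n`, so it is met only at `j = 0`,
          -- where its message is the point mass at `ζ w`.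
          · have h1 : ¬lev w ≤ n := fun h => hwR ((hR w).2 ⟨h, hU⟩)
            have : j = 0 := by omega
            rw [this]; rfl)
        (fun w hw hwR => by
          refine message_of_mem ?_ ζ _
          by_contra hU
          exact hwR ((hR w).2 ⟨by omega, hU⟩))
        (fun w hw hwR => message_succ ((hR w).1 hwR).2 ζ j)
      exact ⟨K * K', fun g => by rw [hK, hK', mul_assoc]⟩
  obtain ⟨K, hK⟩ := step (n + 1) 0 (by omega)
  refine ⟨K, fun g => ?_⟩
  have hR1 : (R.filter fun w => lev w ≤ n + 1) = R :=
    Finset.filter_true_of_mem fun w hw => ((hR w).1 hw).1.trans (Nat.le_succ n)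
  have hR0 : (R.filter fun w => lev w ≤ 0) = {r} := by
    ext w
    rw [Finset.mem_filter, Nat.le_zero, ← hr.mem_levelSet, levelSet, Finset.mem_singleton]
    constructor
    · exact fun h => h.2
    · rintro rfl
      exact ⟨(hR w).2 ⟨hr.lev_root.le.trans (Nat.zero_le n), hrU⟩, rfl⟩
  have h1 := hK g
  rw [hR1, hR0] at h1
  rw [sumRecolor_mul_prod {r} (G := fun _ => 1)
    (h := fun _ _ c => g c * message ch U ζ (n + 1) r c)] at h1
  · rw [one_mul, Finset.prod_singleton] at h1
    rw [← h1]
    unfold sumRecolor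
    refine Finset.sum_congr rfl fun η _ => ?_
    rw [peeledWeight]
    have e : ∏ w ∈ levelSet ch r (n + 1), message ch U ζ 0 w (Function.updateFinset ζ R η w) = 1 := by
      refine Finset.prod_eq_one fun w hw => ?_
      rw [updateFinset_of_notMem, message, Pi.single_eq_same]
      intro h
      have := ((hR w).1 h).1
      rw [hr.mem_levelSet.1 hw] at this
      omega
    rw [e, mul_one]
  · intro η
    simp [peeledWeight, properUpTo, levelSet]

/-- For a recoloring of a coloring inside the first `n` levels, properness is decided by the edges
between the first `n + 2` levels. -/
lemma IsRooting.properUpTo_eq_ite (hr : IsRooting G r ch lev) {par : V → V}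
    (hpar : ∀ {u w}, w ∈ ch u → par w = u) {n : ℕ} {R : Finset V} (hR : ∀ w ∈ R, lev w ≤ n)
    (σ : QColoring G 4) (η : R → Fin 4)
    [Decidable (∀ u w, G.Adj u w →
      Function.updateFinset σ.1 R η u ≠ Function.updateFinset σ.1 R η w)] :
    properUpTo ch r par (n + 1) (Function.updateFinset σ.1 R η) =
      if ∀ u w, G.Adj u w → Function.updateFinset σ.1 R η u ≠ Function.updateFinset σ.1 R η w
      then 1 else 0 := by
  split_ifs with h
  · refine Finset.prod_eq_one fun j _ => Finset.prod_eq_one fun w hw => if_neg ?_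
    obtain ⟨u, hu, huw⟩ := Finset.mem_biUnion.1 hw
    rw [hpar huw]
    exact h u w (hr.adj_iff.2 (Or.inl huw))
  · by_contra h0
    refine h ?_
    have key : ∀ u w, w ∈ ch u →
        Function.updateFinset σ.1 R η u ≠ Function.updateFinset σ.1 R η w := by
      intro u w hw
      have hl := hr.lev_child hw
      rcases Nat.lt_or_ge n (lev u) with hu | hu
      · rw [updateFinset_of_notMem fun h => by have := hR u h; omega,
          updateFinset_of_notMem fun h => by have := hR w h; omega]
        exact σ.2 u w (hr.adj_iff.2 (Or.inl hw))
      · intro he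
        refine h0 (Finset.prod_eq_zero (i := lev u) (by rw [Finset.mem_range]; omega) ?_)
        refine Finset.prod_eq_zero (i := w) (hr.mem_levelSet.2 hl) ?_
        rw [hpar hw, if_pos he]
    intro u w huw
    rcases hr.adj_iff.1 huw with h1 | h1
    · exact key u w h1
    · exact (key w u h1).symm

end Levels

/-! ### Finite-volume marginals as messages. -/

section Marginal

variable {V : Type*} [DecidableEq V] {G : SimpleGraph V} {r : V} {ch : V → Finset V} {lev : V → ℕ}

lemma mem_regionColorings_iff {R : Finset V} {σ : QColoring G 4} {η : R → Fin 4} :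
    (show ↥(R : Set V) → Fin 4 from η) ∈ regionColorings (R : Set V) σ ↔ ∀ u w, G.Adj u w →
      Function.updateFinset σ.1 R η u ≠ Function.updateFinset σ.1 R η w := by
  constructor
  · rintro ⟨τ, h1, h2⟩
    have e : Function.updateFinset σ.1 R η = τ.1 := by
      funext x
      by_cases hx : x ∈ R
      · rw [← h2]
        simp [Function.updateFinset, hx, QColoring.restr]
      · rw [updateFinset_of_notMem hx, h1 x (by simpa using hx)]
    rw [e]
    exact τ.2
  · intro h
    refine ⟨⟨_, h⟩, fun x hx => updateFinset_of_notMem (by simpa using hx), ?_⟩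
    funext x
    have hx : x.1 ∈ R := x.2
    simp [QColoring.restr, Function.updateFinset, hx]

/-- The marginal at the root of the uniform coloring of the free vertices of the first `n + 1`
levels is given by the sum-product recursion. -/
lemma IsRooting.uniformOn_regionColorings (hr : IsRooting G r ch lev) {U : Set V} (hrU : r ∉ U)
    {n : ℕ} {R : Finset V} (hR : ∀ w, w ∈ R ↔ lev w ≤ n ∧ w ∉ U) (hrR : r ∈ (R : Set V))
    (σ : QColoring G 4) (c : Fin 4) :
    uniformOn (regionColorings (R : Set V) σ) {ξ | ξ ⟨r, hrR⟩ = c}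
      = ENNReal.ofReal (message ch U σ.1 (n + 1) r c) := by
  classical
  obtain ⟨par, hpar⟩ : ∃ par : V → V, ∀ {u w}, w ∈ ch u → par w = u := by
    refine ⟨fun w => if h : ∃ u, w ∈ ch u then h.choose else w, fun {u w} h => ?_⟩
    have h' : ∃ u, w ∈ ch u := ⟨u, h⟩
    simp only [dif_pos h']
    exact hr.parent_unique h'.choose_spec h
  set S : Finset (↥(R : Set V) → Fin 4) :=
    Finset.univ.filter fun η => η ∈ regionColorings (R : Set V) σ with hS
  set T : Finset (↥(R : Set V) → Fin 4) := Finset.univ.filter fun η => η ⟨r, hrR⟩ = c with hT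
  have eS : regionColorings (R : Set V) σ = (S : Set (↥(R : Set V) → Fin 4)) := by
    ext η; simp [hS]
  have eT : {ξ : ↥(R : Set V) → Fin 4 | ξ ⟨r, hrR⟩ = c} = (T : Set (↥(R : Set V) → Fin 4)) := by
    ext η; simp [hT]
  rw [eS, eT, uniformOn_apply_finset]
  obtain ⟨K, hK⟩ := hr.exists_sumRecolor_eq hpar hrU hR σ.1
  -- With `P` always true this identifies `K` as the number of colorings of the region; with `P`
  -- singling out `c` it gives the numerator of the marginal.
  have count : ∀ (P : Fin 4 → Prop) [DecidablePred P], ((S.filter fun η => P (η ⟨r, hrR⟩)).card : ℝ)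
      = K * ∑ c, (if P c then 1 else 0) * message ch U σ.1 (n + 1) r c := by
    intro P _
    rw [← hK fun c => if P c then 1 else 0, Finset.card_filter, hS, Finset.sum_filter, sumRecolor]
    push_cast
    refine Finset.sum_congr rfl fun η _ => ?_
    have e1 := hr.properUpTo_eq_ite hpar (fun w hw => ((hR w).1 hw).1) σ η
    have e2 : Function.updateFinset σ.1 R η r = η ⟨r, hrR⟩ := by
      have : r ∈ R := hrR
      simp [Function.updateFinset, this]
    rw [e1, e2]
    have e3 := mem_regionColorings_iff (σ := σ) (η := η)
    by_cases h : η ∈ regionColorings (R : Set V) σ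
    · rw [if_pos h, if_pos (e3.1 h)]
      simp
    · rw [if_neg h, if_neg fun h' => h (e3.2 h')]
      simp
  have hprob := hr.isProb4_message (U := U) σ.1 (n + 1) r
  have cS : (S.card : ℝ) = K := by
    have := count fun _ => True
    simpa [hprob.sum_eq] using this
  have cST : ((S ∩ T).card : ℝ) = K * message ch U σ.1 (n + 1) r c := by
    have h1 := count fun k => k = c
    have h2 : S ∩ T = S.filter fun η => η ⟨r, hrR⟩ = c := by
      ext η; simp [hT]
    rw [h2, h1]
    simp
  have hne : S.Nonempty := ⟨σ.restr R, by
    rw [hS, Finset.mem_filter]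
    exact ⟨Finset.mem_univ _, σ, fun _ _ => rfl, rfl⟩⟩
  have hpos : (0 : ℝ) < S.card := by exact_mod_cast hne.card_pos
  have hm : message ch U σ.1 (n + 1) r c = ((S ∩ T).card : ℝ) / S.card := by
    rw [cST, cS, mul_div_cancel_left₀]
    rw [← cS]
    exact hpos.ne'
  rw [hm, ENNReal.ofReal_div_of_pos hpos, ENNReal.ofReal_natCast, ENNReal.ofReal_natCast]

end Marginal

/-! ### The infinite-volume conditional marginal. -/

section Limit

variable {V : Type*} {G : SimpleGraph V} {r : V} {ch : V → Finset V} {lev : V → ℕ}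

lemma measurable_restr {V : Type*} {G : SimpleGraph V} (U : Set V) :
    Measurable (QColoring.restr U : QColoring G 4 → U → Fin 4) :=
  measurable_pi_lambda _ fun u => (measurable_pi_apply u.1).comp measurable_subtype_coe

/-- The extension of a partial coloring by the color `0`. -/
noncomputable def extendColors {V : Type*} (U : Set V) (τ : U → Fin 4) : V → Fin 4 :=
  open scoped Classical in fun w => if h : w ∈ U then τ ⟨w, h⟩ else 0

lemma extendColors_of_mem {V : Type*} {U : Set V} (τ : U → Fin 4) {w : V} (h : w ∈ U) :
    extendColors U τ w = τ ⟨w, h⟩ := by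
  simp [extendColors, h]

lemma measurable_extendColors {V : Type*} (U : Set V) : Measurable (extendColors U) := by
  refine measurable_pi_lambda _ fun w => ?_
  by_cases h : w ∈ U
  · simp only [extendColors_of_mem _ h]
    exact measurable_pi_apply _
  · simp only [extendColors, h, dite_false]
    exact measurable_const

lemma measurable_message (ch : V → Finset V) (U : Set V) (n : ℕ) (w : V) (c : Fin 4) :
    Measurable fun ζ : V → Fin 4 => message ch U ζ n w c := by
  have hs : ∀ w c, Measurable fun ζ : V → Fin 4 => (Pi.single (ζ w) 1 : Fin 4 → ℝ) c := fun w c =>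
    (measurable_of_finite fun k : Fin 4 => (Pi.single k 1 : Fin 4 → ℝ) c).comp
      (measurable_pi_apply w)
  induction n generalizing w c with
  | zero => exact hs w c
  | succ n ih =>
    by_cases hw : w ∈ U
    · simp only [message_of_mem hw]
      exact hs w c
    · simp only [message_succ hw, normalize4]
      have hp : ∀ c, Measurable fun ζ : V → Fin 4 => ∏ i ∈ ch w, (1 - message ch U ζ n i c) :=
        fun c => Finset.measurable_fun_prod _ fun i _ => measurable_const.sub (ih i c)
      exact (hp c).div (Finset.measurable_fun_sum _ fun k _ => hp k)

lemma tendsto_decay : Filter.Tendsto (fun k : ℕ => 13 * (40 / 41 : ℝ) ^ k) Filter.atTop (nhds 0) := by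
  simpa using (tendsto_pow_atTop_nhds_zero_of_lt_one (by norm_num : (0 : ℝ) ≤ 40 / 41)
    (by norm_num)).const_mul 13

lemma IsRooting.exists_tendsto_message (hr : IsRooting G r ch lev) {U : Set V} (hrU : r ∉ U)
    (ζ : V → Fin 4) (c : Fin 4) :
    ∃ x, Filter.Tendsto (fun n => message ch U ζ n r c) Filter.atTop (nhds x) := by
  -- The decay estimate is applied to the same data `ζ` at two depths, both at least `N`.
  refine cauchySeq_tendsto_of_complete (cauchySeq_of_le_tendsto_0 _ (fun n m N hn hm => ?_)
    tendsto_decay)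
  rw [Real.dist_eq]
  exact (abs_sub_le_dist4 _ _ c).trans
    (hr.dist4_message_root_le hrU (d := N) (fun _ _ _ => rfl) N hn hm le_rfl)

/-- The infinite-volume conditional marginal at `r`: the limit of the root messages. -/
noncomputable def limitMarginal {V : Type*} (ch : V → Finset V) (r : V) (U : Set V)
    (τ : U → Fin 4) (c : Fin 4) : ℝ :=
  Filter.limUnder Filter.atTop fun n => message ch U (extendColors U τ) n r c

lemma IsRooting.tendsto_limitMarginal (hr : IsRooting G r ch lev) {U : Set V} (hrU : r ∉ U)
    (τ : U → Fin 4) (c : Fin 4) :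
    Filter.Tendsto (fun n => message ch U (extendColors U τ) n r c) Filter.atTop
      (nhds (limitMarginal ch r U τ c)) :=
  tendsto_nhds_limUnder (hr.exists_tendsto_message hrU _ c)

lemma IsRooting.isProb4_limitMarginal (hr : IsRooting G r ch lev) {U : Set V} (hrU : r ∉ U)
    (τ : U → Fin 4) : IsProb4 (limitMarginal ch r U τ) where
  nonneg c := ge_of_tendsto' (hr.tendsto_limitMarginal hrU τ c) fun n =>
    (hr.isProb4_message _ n r).nonneg c
  sum_eq := by
    have h := tendsto_finsetSum Finset.univ fun c _ => hr.tendsto_limitMarginal hrU τ c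
    simp only [(hr.isProb4_message _ _ r).sum_eq] at h
    exact tendsto_nhds_unique h tendsto_const_nhds

lemma IsRooting.measurable_limitMarginal (hr : IsRooting G r ch lev) {U : Set V} (hrU : r ∉ U)
    (c : Fin 4) : Measurable fun τ => limitMarginal ch r U τ c :=
  measurable_of_tendsto_metrizable
    (fun n => (measurable_message ch U n r c).comp (measurable_extendColors U))
    (tendsto_pi_nhds.2 fun τ => hr.tendsto_limitMarginal hrU τ c)

lemma IsRooting.dist4_limitMarginal_le (hr : IsRooting G r ch lev) {U : Set V} (hrU : r ∉ U)
    {τ τ' : U → Fin 4} {d : ℕ} (h : ∀ u : U, lev u < d → τ u = τ' u) :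
    dist4 (limitMarginal ch r U τ) (limitMarginal ch r U τ') ≤ 13 * (40 / 41) ^ d := by
  refine le_of_tendsto (tendsto_finsetSum Finset.univ fun c _ =>
    ((hr.tendsto_limitMarginal hrU τ c).sub (hr.tendsto_limitMarginal hrU τ' c)).abs)
    (Filter.eventually_atTop.2 ⟨d, fun n hn => ?_⟩)
  refine hr.dist4_message_root_le hrU (fun u hu hl => ?_) d hn hn le_rfl
  rw [extendColors_of_mem _ hu, extendColors_of_mem _ hu]
  exact h ⟨u, hu⟩ hl

/-- The coloring and the extension of its restriction agree on `U`; what the messages read off `U`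
lies at depth `n`, and its influence decays. -/
lemma IsRooting.tendsto_message_coloring (hr : IsRooting G r ch lev) {U : Set V} (hrU : r ∉ U)
    (σ : QColoring G 4) (c : Fin 4) :
    Filter.Tendsto (fun n => message ch U σ.1 n r c) Filter.atTop
      (nhds (limitMarginal ch r U (σ.restr U) c)) := by
  have h0 : Filter.Tendsto (fun n => message ch U σ.1 n r c
      - message ch U (extendColors U (σ.restr U)) n r c) Filter.atTop (nhds 0) := by
    refine squeeze_zero_norm (fun n => ?_) tendsto_decay
    rw [Real.norm_eq_abs]
    refine (abs_sub_le_dist4 _ _ c).trans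
      (hr.dist4_message_root_le hrU (d := n) (fun u hu _ => ?_) n le_rfl le_rfl le_rfl)
    rw [extendColors_of_mem _ hu]
    rfl
  simpa using h0.add (hr.tendsto_limitMarginal hrU (σ.restr U) c)

/-- The conditional marginals at `r` form a Markov kernel. -/
lemma IsRooting.exists_kernel (hr : IsRooting G r ch lev) {U : Set V} (hrU : r ∉ U) :
    ∃ κ : Kernel (U → Fin 4) (Fin 4), IsMarkovKernel κ ∧
      ∀ τ c, κ τ {c} = ENNReal.ofReal (limitMarginal ch r U τ c) := by
  let μ : (U → Fin 4) → Measure (Fin 4) := fun τ =>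
    ∑ c, ENNReal.ofReal (limitMarginal ch r U τ c) • Measure.dirac c
  have hμ : ∀ τ s, μ τ s = ∑ c, ENNReal.ofReal (limitMarginal ch r U τ c) * Measure.dirac c s :=
    fun τ s => by simp [μ]
  have hmeas : Measurable μ := by
    refine Measure.measurable_of_measurable_coe _ fun s _ => ?_
    simp only [hμ]
    exact Finset.measurable_fun_sum _ fun c _ =>
      (hr.measurable_limitMarginal hrU c).ennreal_ofReal.mul_const _
  refine ⟨⟨μ, hmeas⟩, ⟨fun τ => ⟨?_⟩⟩, fun τ c => ?_⟩
  · change μ τ Set.univ = 1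
    have hp := hr.isProb4_limitMarginal hrU τ
    simp only [hμ, measure_univ, mul_one]
    rw [← ENNReal.ofReal_sum_of_nonneg fun c _ => hp.nonneg c, hp.sum_eq, ENNReal.ofReal_one]
  · change μ τ {c} = _
    rw [hμ, Finset.sum_eq_single c]
    · simp
    · intro k _ hk
      simp [hk]
    · simp

/-- The finite-volume form of the conditional marginal under a Gibbs measure. -/
lemma IsGibbsMeasure.measure_inter_eq (hr : IsRooting G r ch lev) {p : Measure (QColoring G 4)}
    (hp : IsGibbsMeasure G 4 p) {U : Set V} (hrU : r ∉ U) (n : ℕ) {A : Set (U → Fin 4)}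
    (hA : MeasurableSet A) (c : Fin 4) :
    p (QColoring.restr U ⁻¹' A ∩ {σ | σ.1 r = c})
      = ∫⁻ σ in QColoring.restr U ⁻¹' A, ENNReal.ofReal (message ch U σ.1 (n + 1) r c) ∂p := by
  classical
  have := hp.1
  -- The region consists of the free vertices of level at most `n`. Its complement contains `U`, so
  -- an event determined by the colors on `U` is one on which the Gibbs property for `R` can be
  -- integrated.
  set R : Finset V := ((Finset.range (n + 1)).biUnion (levelSet ch r)).filter (· ∉ U) with hRdef
  have hR : ∀ w, w ∈ R ↔ lev w ≤ n ∧ w ∉ U := fun w => by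
    simp [hRdef, hr.mem_levelSet]
  have hrR : r ∈ (R : Set V) := (hR r).2 ⟨hr.lev_root.le.trans (Nat.zero_le n), hrU⟩
  have hUR : ∀ u : U, u.1 ∈ (R : Set V)ᶜ := fun u h => ((hR u).1 h).2 u.2
  obtain ⟨κ, ⟨hκ, hmap⟩, hunif⟩ := hp.2 (R : Set V) R.finite_toSet
  set A' : Set (((R : Set V)ᶜ : Set V) → Fin 4) := {x | (fun u : U => x ⟨u, hUR u⟩) ∈ A} with hA'
  have mA' : MeasurableSet A' :=
    (measurable_pi_lambda _ fun u => measurable_pi_apply _ :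
      Measurable fun (x : ((R : Set V)ᶜ : Set V) → Fin 4) (u : U) => x ⟨u, hUR u⟩) hA
  set B : Set (↥(R : Set V) → Fin 4) := {ξ | ξ ⟨r, hrR⟩ = c} with hB
  have mB : MeasurableSet B :=
    (measurable_pi_apply _ : Measurable fun ξ : ↥(R : Set V) → Fin 4 => ξ ⟨r, hrR⟩)
      (measurableSet_singleton c)
  have h1 := DFunLike.congr_fun hmap (A' ×ˢ B)
  rw [Measure.map_apply ((measurable_restr _).prodMk (measurable_restr _)) (mA'.prod mB),
    Measure.compProd_apply_prod mA' mB,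
    setLIntegral_map mA' (κ.measurable_coe mB) (measurable_restr _)] at h1
  calc p (QColoring.restr U ⁻¹' A ∩ {σ | σ.1 r = c}) = _ := h1
    _ = _ := lintegral_congr fun σ => by
      rw [hunif σ, hr.uniformOn_regionColorings hrU hR hrR]

lemma IsGibbsMeasure.isCondDistribution (hr : IsRooting G r ch lev) {p : Measure (QColoring G 4)}
    (hp : IsGibbsMeasure G 4 p) {U : Set V} (hrU : r ∉ U) {κ : Kernel (U → Fin 4) (Fin 4)}
    (hκ : IsMarkovKernel κ)
    (hκ' : ∀ τ c, κ τ {c} = ENNReal.ofReal (limitMarginal ch r U τ c)) :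
    IsCondDistribution p (fun σ : QColoring G 4 => σ.1 r) (QColoring.restr U) κ := by
  have := hp.1
  refine ⟨hκ, ?_⟩
  have mY : Measurable fun σ : QColoring G 4 => σ.1 r :=
    (measurable_pi_apply r).comp measurable_subtype_coe
  have mXY : Measurable fun σ : QColoring G 4 => (σ.restr U, σ.1 r) :=
    (measurable_restr U).prodMk mY
  have main : ∀ {A : Set (U → Fin 4)}, MeasurableSet A → ∀ c,
      p.map (fun σ => (σ.restr U, σ.1 r)) (A ×ˢ {c}) = ((p.map (QColoring.restr U)).compProd κ)
        (A ×ˢ {c}) := by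
    intro A hA c
    have mc : MeasurableSet ({c} : Set (Fin 4)) := measurableSet_singleton c
    rw [Measure.map_apply mXY (hA.prod mc), Measure.compProd_apply_prod hA mc,
      setLIntegral_map hA (κ.measurable_coe mc) (measurable_restr U)]
    simp only [hκ']
    -- The finite-volume identity has a left-hand side independent of `n`; the integrands on the
    -- right are bounded by `1` and converge pointwise.
    have lim := tendsto_lintegral_of_dominated_convergence
      (μ := p.restrict (QColoring.restr U ⁻¹' A))
      (F := fun n σ => ENNReal.ofReal (message ch U σ.1 (n + 1) r c))
      (f := fun σ => ENNReal.ofReal (limitMarginal ch r U (σ.restr U) c)) (fun _ => 1)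
      (fun n => ((measurable_message ch U (n + 1) r c).comp measurable_subtype_coe).ennreal_ofReal)
      (fun n => Filter.Eventually.of_forall fun σ =>
        ENNReal.ofReal_le_one.2 ((hr.isProb4_message _ _ r).le_one c))
      (by simp)
      (Filter.Eventually.of_forall fun σ => (ENNReal.continuous_ofReal.tendsto _).comp
        ((Filter.tendsto_add_atTop_iff_nat 1).2 (hr.tendsto_message_coloring hrU σ c)))
    refine tendsto_nhds_unique (tendsto_const_nhds.congr fun n => ?_) lim
    exact hp.measure_inter_eq hr hrU n hA c
  refine Measure.ext_prod fun {A t} hA _ => ?_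
  -- For fixed `A` both sides become measures on the finite color set, which are determined by
  -- singletons.
  have hext : ∀ ν : Measure ((U → Fin 4) × Fin 4), ∀ t,
      ν (A ×ˢ t) = (ν.restrict (A ×ˢ Set.univ)).map Prod.snd t := fun ν t => by
    rw [Measure.map_apply measurable_snd t.toFinite.measurableSet,
      Measure.restrict_apply (measurable_snd t.toFinite.measurableSet)]
    congr 1
    ext x
    simp [and_comm]
  rw [hext, hext]
  congr 1
  refine Measure.ext_of_singleton fun c => ?_
  rw [← hext, ← hext]
  exact main hA c

end Limit

/-! ### Strong spatial mixing. -/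

theorem theorem2 {V : Type*} (G : SimpleGraph V) (hG : IsCayleyTree 2 G) :
    ∃ C a : ℝ, 0 < C ∧ 0 < a ∧
      ∀ p : Measure (QColoring G 4), IsGibbsMeasure G 4 p →
        HasStrongSpatialMixing G 4 p (fun d => C * Real.exp (-a * d)) := by
  classical
  -- The exponent is chosen so that `exp (-a * d) = (40 / 41) ^ d`.
  refine ⟨13, Real.log (41 / 40), by norm_num, Real.log_pos (by norm_num), fun p hp r U hrU => ?_⟩
  obtain ⟨ch, hr⟩ := hG.exists_isRooting r
  obtain ⟨κ, hκ, hκ'⟩ := hr.exists_kernel hrU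
  refine ⟨κ, hp.isCondDistribution hr hrU hκ hκ', fun σ φ _ => ?_⟩
  set d := distToSet G r (disagreement U σ φ) with hd
  have hrate : Real.exp (-Real.log (41 / 40) * d) = (40 / 41) ^ d := by
    rw [← Real.log_inv, mul_comm, Real.exp_nat_mul, Real.exp_log (by norm_num)]
    norm_num
  have key : dist4 (limitMarginal ch r U (σ.restr U)) (limitMarginal ch r U (φ.restr U))
      ≤ 13 * (40 / 41) ^ d := by
    refine hr.dist4_limitMarginal_le hrU fun u hu => ?_
    by_contra hne
    -- A vertex of `U` where the colorings differ is at distance at least `d`, so below level `d`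
    -- they agree on `U`.
    have h1 : d ≤ G.dist r u := Nat.sInf_le ⟨u, ⟨u.2, hne⟩, rfl⟩
    omega
  have hreal : ∀ (τ : U → Fin 4) c, (κ τ).real {c} = limitMarginal ch r U τ c := fun τ c => by
    rw [Measure.real, hκ', ENNReal.toReal_ofReal ((hr.isProb4_limitMarginal hrU τ).nonneg c)]
  have htv : tvDist (κ (σ.restr U)) (κ (φ.restr U))
      = 1 / 2 * dist4 (limitMarginal ch r U (σ.restr U)) (limitMarginal ch r U (φ.restr U)) := by
    simp only [tvDist, hreal, dist4]
  simp only [htv, hrate]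
  linarith [dist4_nonneg (limitMarginal ch r U (σ.restr U)) (limitMarginal ch r U (φ.restr U))]
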